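/- Let $\mathcal N=\mathbb R^3\times S^1$ be the Nappi--Witten space, with coordinates $(x,y,\theta,t)$, $\theta\in\mathbb R/2\pi\mathbb Z$, Lorentzian metric $ds^2=dx^2+dy^2+2\,d\theta\,dt+(y\,dx-x\,dy)\,d\theta$ (the case $b=0$) and left-invariant orthonormal frame $$U_0=\tfrac1{\sqrt2}(-\partial_\theta+\partial_t),\quad U_1=\cos\theta\,\partial_x+\sin\theta\,\partial_y+\tfrac12(-y\cos\theta+x\sin\theta)\partial_t,$$ $$U_2=-\sin\theta\,\partial_x+\cos\theta\,\partial_y+\tfrac12(x\cos\theta+y\sin\theta)\partial_t,\quad U_3=\tfrac1{\sqrt2}(\partial_\theta+\partial_t),$$ with dual coframe $(U^a)$. Let $\mathcal M=\mathbb R^{1,3}$ have coordinates $(X_1,X_2,U,V)$, metric $dX_1^2+dX_2^2-2\,dU\,dV$, orthonormal coframe $e^0=\frac{dU+dV}{\sqrt2}$, $e^1=dX_1$, $e^2=dX_2$, $e^3=\frac{dU-dV}{\sqrt2}$ and dual frame $(e_a)$. Let $\gamma^0,\dots,\gamma^3$ be the Weyl gamma matrices $$\gamma^0=\begin{pmatrix}0&1\\1&0\end{pmatrix},\qquad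 \gamma^j=\begin{pmatrix}0&\sigma_j\\-\sigma_j&0\end{pmatrix}$$ ($2\times2$ blocks, $\sigma_j$ the Pauli matrices), which satisfy $\gamma^a\gamma^b+\gamma^b\gamma^a=-2g^{ab}$, $(g^{ab})=\mathrm{diag}(-1,1,1,1)$. For an orthonormal frame $(E_\mu)$ and a real one-form $A$ (a $U(1)$ connection) the twisted Dirac operator on $\mathbb C^4$-valued functions is $$D_A\Psi=\sum_\mu\gamma^\mu\Bigl(E_\mu\Psi+iA(E_\mu)\Psi-\tfrac14\sum_{\nu,\rho}\langle E_\nu,\nabla_{E_\mu}E_\rho\rangle\,\gamma^\nu\gamma^\rho\,\Psi\Bigr),$$ with $\nabla$ the Levi-Civita connection; a harmonic spinor is a smooth $\Psi$ with $D_A\Psi=0$. The frames used are $(U_\mu)$ on $\mathcal N$ and $(e_\mu)$ on $\mathcal M$. Let $\mathcal N^*=\mathcal N\setminus\{\theta=\pi\}$, let $H:\mathcal M\to\mathcal N^*$ be the conformal map $$x=\frac{2(2X_1-UX_2)}{4+U^2},\quad y=\frac{2(UX_1+2X_2)}{4+U^2},\quad \theta=2\arctan\frac U2,\quad t=-V+\frac{U(X_1^2+X_2^2)}{2(4+U^2)},$$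 and let $\Omega=\frac12\sqrt{4+U^2}$ be the conformal factor. Let $\mathrm{Pin}(1,3)$ be the group of matrices generated by the $\sum_a v_a\gamma^a$ with $v\in\mathbb R^4$ and $-v_0^2+v_1^2+v_2^2+v_3^2=\pm1$. Then: 1. There is exactly one function $G$ on $\mathcal M$ with values in the real $4\times4$ matrices that relates the two orthonormal coframes by $e^a=\Omega\sum_b G^a{}_b\,H^*U^b$, and its values lie in the Lorentz group $O(1,3)$. 2. $G$ has a spin lift, that is, a continuous $S(G):\mathcal M\to\mathrm{Pin}(1,3)$ with $S(G)^{-1}\gamma^aS(G)=\sum_b G^a{}_b\gamma^b$ for all $a$. 3. For every such lift $S(G)$, every smooth one-form $A$ on $\mathcal N$ and every harmonic spinor $\Psi:\mathcal N\to\mathbb C^4$ for the Dirac operator $D_{\mathcal N,A}$, the spinor $\Psi_{\mathcal M}=S(G)\,\Omega^{-3/2}\,H^*\Psi$ is a harmonic spinor on $\mathcal M$ for the Dirac operator twisted by $H^*A$. -/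

import Mathlib

open scoped Matrix ContDiff

noncomputable section

namespace NappiWitten

/-- Coordinate vectors in `ℝ⁴`. -/
abbrev Coord : Type := Fin 4 → ℝ

/-- Dirac spinors. -/
abbrev Spinor : Type := Fin 4 → ℂ

/-! ## Gamma matrices and the group `Pin(1,3)` -/

/-- The diagonal entries of `diag(-1,1,1,1)`; the index `0` is the time index. -/
def eta : Fin 4 → ℝ := ![-1, 1, 1, 1]

/-- The gamma matrices `γ⁰, γ¹, γ², γ³` in the Weyl representation. -/
def gamma : Fin 4 → Matrix (Fin 4) (Fin 4) ℂ :=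
  ![!![0, 0, 1, 0; 0, 0, 0, 1; 1, 0, 0, 0; 0, 1, 0, 0],
    !![0, 0, 0, 1; 0, 0, 1, 0; 0, -1, 0, 0; -1, 0, 0, 0],
    !![0, 0, 0, -Complex.I; 0, 0, Complex.I, 0; 0, Complex.I, 0, 0; -Complex.I, 0, 0, 0],
    !![0, 0, 1, 0; 0, 0, 0, -1; -1, 0, 0, 0; 0, 1, 0, 0]]

/-- The Clifford relations `γᵃ γᵇ + γᵇ γᵃ = -2 gᵃᵇ`. -/
theorem gamma_clifford (a b : Fin 4) :
    gamma a * gamma b + gamma b * gamma a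
      = if a = b then ((-2 * eta a : ℝ) : ℂ) • (1 : Matrix (Fin 4) (Fin 4) ℂ) else 0 := by
  have h1 : (1 : Matrix (Fin 4) (Fin 4) ℂ)
      = !![1, 0, 0, 0; 0, 1, 0, 0; 0, 0, 1, 0; 0, 0, 0, 1] := by
    ext i j; fin_cases i <;> fin_cases j <;> simp
  have h0 : (0 : Matrix (Fin 4) (Fin 4) ℂ)
      = !![0, 0, 0, 0; 0, 0, 0, 0; 0, 0, 0, 0; 0, 0, 0, 0] := by
    ext i j; fin_cases i <;> fin_cases j <;> simp
  rw [h1, h0]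
  fin_cases a <;> fin_cases b <;> simp [gamma, eta] <;> norm_num

/-- `Pin(1,3)`, realised in the Weyl representation: the group of all products of unit vectors
`v = ∑ vₐ γᵃ`, where `v` is real with `-v₀² + v₁² + v₂² + v₃² = ±1`. (Each such `v` has
`v² = ∓1` and `γ⁰ γ⁰ = 1`, `γ¹ γ¹ = -1`, so that the monoid they generate is a group.) -/
def Pin13 : Submonoid (Matrix (Fin 4) (Fin 4) ℂ) :=
  Submonoid.closure
    {M | ∃ v : Coord, (∑ a, eta a * v a ^ 2 = 1 ∨ ∑ a, eta a * v a ^ 2 = -1) ∧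
      M = ∑ a, (v a : ℂ) • gamma a}

/-- `G ∈ O(1,3)`. -/
def IsLorentz (G : Matrix (Fin 4) (Fin 4) ℝ) : Prop :=
  Gᵀ * Matrix.diagonal eta * G = Matrix.diagonal eta

/-! ## The twisted Dirac operator of a Lorentzian metric with an orthonormal frame -/

/-- A Lorentzian metric on `ℝ⁴` with a global orthonormal frame `E₀, E₁, E₂, E₃`
(`E₀` is timelike). -/
structure FramedMetric where
  /-- the metric -/
  metric : Coord → LinearMap.BilinForm ℝ Coord
  /-- the frame of vector fields -/
  frame : Fin 4 → Coord → Coord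
  /-- the frame is orthonormal -/
  orthonormal : ∀ q a b, metric q (frame a q) (frame b q) = if a = b then eta a else 0

/-- The dual coframe `Eᵃ(v) = gᵃᵃ ⟨Eₐ, v⟩`. -/
def FramedMetric.coframe (F : FramedMetric) (a : Fin 4) (q v : Coord) : ℝ :=
  eta a * F.metric q (F.frame a q) v

/-- The components `ω_{νρ}(E_μ) = ⟨E_ν, ∇_{E_μ} E_ρ⟩` of the Levi-Civita connection `∇` in the
orthonormal frame, given by the Koszul formula
`2⟨∇_X Y, Z⟩ = ⟨[X,Y],Z⟩ - ⟨[Y,Z],X⟩ + ⟨[Z,X],Y⟩`,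
in which the derivatives of the (constant) products of frame fields drop out. -/
def FramedMetric.connection (F : FramedMetric) (q : Coord) (μ ν ρ : Fin 4) : ℝ :=
  (F.metric q (VectorField.lieBracket ℝ (F.frame μ) (F.frame ρ) q) (F.frame ν q)
    - F.metric q (VectorField.lieBracket ℝ (F.frame ρ) (F.frame ν) q) (F.frame μ q)
    + F.metric q (VectorField.lieBracket ℝ (F.frame ν) (F.frame μ) q) (F.frame ρ q)) / 2

/-- The twisted spinor covariant derivative along `E_μ`, for the `U(1)` connection `A`:
`E_μ Ψ + i A(E_μ) Ψ - ¼ ∑ ω_{νρ}(E_μ) γ^ν γ^ρ Ψ`.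
The sign of the last term is the one for which, with `γ^a γ^b + γ^b γ^a = -2 g^{ab}`, Clifford
multiplication is parallel (the spin representation of the Levi-Civita connection). -/
def FramedMetric.covDeriv (F : FramedMetric) (A : Coord → Coord →L[ℝ] ℝ) (Ψ : Coord → Spinor)
    (μ : Fin 4) (q : Coord) : Spinor :=
  fderiv ℝ Ψ q (F.frame μ q) + (Complex.I * (A q (F.frame μ q) : ℂ)) • Ψ q
    - (1 / 4 : ℂ) • ∑ ν, ∑ ρ, (F.connection q μ ν ρ : ℂ) • ((gamma ν * gamma ρ) *ᵥ Ψ q)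

/-- The twisted Dirac operator `D_A Ψ = ∑ γ^μ ∇^A_{E_μ} Ψ`. -/
def FramedMetric.dirac (F : FramedMetric) (A : Coord → Coord →L[ℝ] ℝ) (Ψ : Coord → Spinor)
    (q : Coord) : Spinor :=
  ∑ μ, gamma μ *ᵥ F.covDeriv A Ψ μ q

/-! ## The Nappi--Witten space (with `b = 0`) -/

/-- The Nappi--Witten space `ℝ³ × S¹`, with its global coordinates `(x, y, θ, t)`, `θ ∈ ℝ/2πℤ`. -/
@[ext] structure NW where
  /-- the coordinate `x` -/
  x : ℝ
  /-- the coordinate `y` -/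
  y : ℝ
  /-- the coordinate `θ` -/
  θ : Real.Angle
  /-- the coordinate `t` -/
  t : ℝ

/-- The universal covering `ℝ⁴ → 𝒩`. -/
def cover (q : Coord) : NW := ⟨q 0, q 1, (q 2 : Real.Angle), q 3⟩

/-- The bi-invariant metric `dx² + dy² + 2 dθ dt + (y dx - x dy) dθ`, by its Gram matrix in the
coordinates `(x, y, θ, t)`. -/
def nwMetric (n : NW) : LinearMap.BilinForm ℝ Coord :=
  Matrix.toBilin' !![1, 0, n.y / 2, 0; 0, 1, -n.x / 2, 0; n.y / 2, -n.x / 2, 0, 1; 0, 0, 1, 0]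

/-- The left-invariant orthonormal frame `U₀, U₁, U₂, U₃`, in components with respect to
`∂_x, ∂_y, ∂_θ, ∂_t`. -/
def nwFrame (a : Fin 4) (n : NW) : Coord :=
  ![![0, 0, -1 / √2, 1 / √2],
    ![n.θ.cos, n.θ.sin, 0, (-n.y * n.θ.cos + n.x * n.θ.sin) / 2],
    ![-n.θ.sin, n.θ.cos, 0, (n.x * n.θ.cos + n.y * n.θ.sin) / 2],
    ![0, 0, 1 / √2, 1 / √2]] a

theorem nw_orthonormal (n : NW) (a b : Fin 4) :
    nwMetric n (nwFrame a n) (nwFrame b n) = if a = b then eta a else 0 := by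
  have h2 : (√2 : ℝ)⁻¹ * (√2)⁻¹ = 1 / 2 := by
    rw [← mul_inv, Real.mul_self_sqrt (by norm_num)]; norm_num
  have hcs := n.θ.cos_sq_add_sin_sq
  fin_cases a <;> fin_cases b <;>
    simp [nwMetric, nwFrame, eta, Matrix.toBilin'_apply', dotProduct, Matrix.mulVec,
      Fin.sum_univ_four] <;>
    first | done | grind

/-- The metric and the frame of `𝒩`, on the universal cover. -/
def nw : FramedMetric where
  metric q := nwMetric (cover q)
  frame a q := nwFrame a (cover q)
  orthonormal q a b := nw_orthonormal (cover q) a b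

/-- A function on `𝒩` is smooth if and only if its lift to the universal cover is. -/
def NWSmooth {E : Type*} [NormedAddCommGroup E] [NormedSpace ℝ E] (f : NW → E) : Prop :=
  ContDiff ℝ ∞ (f ∘ cover)

/-- `Ψ : 𝒩 → ℂ⁴` is a harmonic spinor for the Dirac operator twisted by the connection `A`
(a one-form on `𝒩`, in components with respect to `dx, dy, dθ, dt`); the covering being a local
diffeomorphism, the equation is written on the cover. -/
def IsHarmonicNW (A : NW → Coord →L[ℝ] ℝ) (Ψ : NW → Spinor) : Prop :=
  NWSmooth Ψ ∧ ∀ q, nw.dirac (A ∘ cover) (Ψ ∘ cover) q = 0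

/-- `𝒩*`: the Nappi--Witten space without the hypersurface `θ = π`. -/
def NWStar : Set NW := {n | n.θ ≠ (Real.pi : Real.Angle)}

/-! ## Minkowski space, with coordinates `(X₁, X₂, U, V)` -/

/-- The metric `dX₁² + dX₂² - 2 dU dV`. -/
def minkMetric : LinearMap.BilinForm ℝ Coord :=
  Matrix.toBilin' !![1, 0, 0, 0; 0, 1, 0, 0; 0, 0, 0, -1; 0, 0, -1, 0]

/-- The frame `e₀ = (∂_U + ∂_V)/√2`, `e₁ = ∂_{X₁}`, `e₂ = ∂_{X₂}`, `e₃ = (∂_U - ∂_V)/√2`, dual to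
the coframe `e⁰ = (dU + dV)/√2`, `e¹ = dX₁`, `e² = dX₂`, `e³ = (dU - dV)/√2`. -/
def minkFrame (a : Fin 4) : Coord :=
  ![![0, 0, 1 / √2, 1 / √2], ![1, 0, 0, 0], ![0, 1, 0, 0], ![0, 0, 1 / √2, -1 / √2]] a

theorem mink_orthonormal (a b : Fin 4) :
    minkMetric (minkFrame a) (minkFrame b) = if a = b then eta a else 0 := by
  have h2 : (√2 : ℝ)⁻¹ * (√2)⁻¹ = 1 / 2 := by
    rw [← mul_inv, Real.mul_self_sqrt (by norm_num)]; norm_num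
  fin_cases a <;> fin_cases b <;>
    simp [minkMetric, minkFrame, eta, Matrix.toBilin'_apply', dotProduct, Matrix.mulVec,
      Fin.sum_univ_four] <;>
    first | done | grind

/-- Minkowski space with its flat metric and frame. -/
def mink : FramedMetric where
  metric _ := minkMetric
  frame a _ := minkFrame a
  orthonormal _ a b := mink_orthonormal a b

/-- `Ψ` is a harmonic spinor on Minkowski space for the Dirac operator twisted by `A`. -/
def IsHarmonicMink (A : Coord → Coord →L[ℝ] ℝ) (Ψ : Coord → Spinor) : Prop :=
  ContDiff ℝ ∞ Ψ ∧ ∀ p, mink.dirac A Ψ p = 0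

/-! ## The conformal map -/

/-- The coordinate expression `(X₁, X₂, U, V) ↦ (x, y, θ, t)` of the conformal map. -/
def HCoord (p : Coord) : Coord :=
  ![2 * (2 * p 0 - p 2 * p 1) / (4 + p 2 ^ 2),
    2 * (p 2 * p 0 + 2 * p 1) / (4 + p 2 ^ 2),
    2 * Real.arctan (p 2 / 2),
    -p 3 + p 2 * (p 0 ^ 2 + p 1 ^ 2) / (2 * (4 + p 2 ^ 2))]

theorem cover_HCoord_mem (p : Coord) : cover (HCoord p) ∈ NWStar := by
  intro h
  have h1 := Real.neg_pi_div_two_lt_arctan (p 2 / 2)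
  have h2 := Real.arctan_lt_pi_div_two (p 2 / 2)
  have h3 : ((2 * Real.arctan (p 2 / 2) : ℝ) : Real.Angle) = (Real.pi : Real.Angle) := h
  have h4 : ((2 * Real.arctan (p 2 / 2) : ℝ) : Real.Angle).toReal = 2 * Real.arctan (p 2 / 2) :=
    Real.Angle.toReal_coe_eq_self_iff.2 ⟨by linarith, by linarith⟩
  rw [h3, Real.Angle.toReal_pi] at h4
  linarith

/-- The conformal map `H` from Minkowski space to `𝒩*`. -/
def H (p : Coord) : NWStar := ⟨cover (HCoord p), cover_HCoord_mem p⟩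

/-- The conformal factor `Ω = √(4 + U²) / 2`. -/
def Omega (p : Coord) : ℝ := √(4 + p 2 ^ 2) / 2

/-- The pulled-back connection `H* A`. -/
def pullbackH (A : NW → Coord →L[ℝ] ℝ) (p : Coord) : Coord →L[ℝ] ℝ :=
  (A (H p)).comp (fderiv ℝ HCoord p)

/-- `G` relates the coframe `(eᵃ)` of Minkowski space to the pullback of the orthonormal coframe
`(Uᵃ)` of `𝒩`: `eᵃ = Ω ∑ Gᵃ_b H* Uᵇ`. -/
def RelatesCoframes (G : Coord → Matrix (Fin 4) (Fin 4) ℝ) : Prop :=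
  ∀ p a v, mink.coframe a p v
    = Omega p * ∑ b, G p a b * nw.coframe b (HCoord p) (fderiv ℝ HCoord p v)

/-- `S` is a (continuous) lift of `G` to `Pin(1,3)`: `S⁻¹ γᵃ S = Gᵃ_b γᵇ`. (The lift takes
values in `Pin` and not only in `Spin` since the two coframes are oppositely oriented, `det G = -1`.) -/
def IsSpinLift (G : Coord → Matrix (Fin 4) (Fin 4) ℝ)
    (S : Coord → Matrix (Fin 4) (Fin 4) ℂ) : Prop :=
  Continuous S ∧ (∀ p, S p ∈ Pin13) ∧
    ∀ p a, (S p)⁻¹ * gamma a * S p = ∑ b, (G p a b : ℂ) • gamma b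

end NappiWitten

end

/-!
The theorem is the conformal covariance of the Dirac operator, made explicit for the map `H`.
With `Z = X₁ + i X₂` and `α = arctan (U/2) = θ/2`, so that `Ω exp (iα) = 1 + iU/2`, the coframes
satisfy `dZ = Ω exp (iα) ((U¹ + i U²) - (i/2) Z dθ)` and `dU = Ω² dθ`. This exhibits `G`
(`confLorentz`) as the composition of a rotation, a boost, a null rotation and the time reversal;
each of these lifts to a product of unit vectors, which gives the spin lift `confSpin`. The coframe
relation says that `Ω G` is inverse to the matrix `diffH` of the differential of `H` in the two
frames, whence `G` is unique.

The frame `(U_a)` satisfies the bracket relations of the Nappi--Witten Lie algebra, and the metric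
is bi-invariant; the connection coefficients are therefore constant and totally antisymmetric, and the
connection enters the Dirac operator of `𝒩` through one constant matrix, `cliffordConnection`. On
Minkowski space the spin connection vanishes. By the product rule, the Dirac operator applied to
`Ω^(-3/2) S H*Ψ` has two parts. The derivatives of `Ψ` and the connection `A` are intertwined by the
lifting property (`sum_gamma_weightedSpin_symbol`), and the derivatives of `Ω^(-3/2) S` give exactly
the connection term of `𝒩` (`sum_gamma_weightedSpinDeriv`). Hence
`D_M (Ω^(-3/2) S H*Ψ) = Ω^(-5/2) S H*(D_N Ψ)` (`mink_dirac_weightedSpin`).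

An arbitrary lift differs from `confSpin` by a scalar function, by Schur's lemma. All elements of
the pin group have determinant one, so that this scalar is a fourth root of unity; being continuous,
it is constant (`IsSpinLift.eq_smul`), and a constant factor preserves harmonic spinors.
-/

noncomputable section

namespace NappiWitten

/-! ### The Dirac operator of the Nappi--Witten frame -/

/-- The derivative along a line, as a directional derivative. -/
theorem hasDerivAt_line {E : Type*} [NormedAddCommGroup E] [NormedSpace ℝ E] {f : Coord → E}
    {q : Coord} (hd : DifferentiableAt ℝ f q) (v : Coord) :
    HasDerivAt (fun s : ℝ => f (q + s • v)) (fderiv ℝ f q v) 0 := by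
  have hl : HasDerivAt (fun s : ℝ => q + s • v) v 0 := by
    simpa using ((hasDerivAt_id (0 : ℝ)).smul_const v).const_add q
  have h := hd.hasFDerivAt
  rw [show q = q + (0 : ℝ) • v by simp] at h
  have h1 := h.comp_hasDerivAt (0 : ℝ) hl
  rw [show q + (0 : ℝ) • v = q by simp] at h1
  exact h1

theorem hasDerivAt_line_apply (q v : Coord) (i : Fin 4) :
    HasDerivAt (fun s : ℝ => q i + s * v i) (v i) 0 := by
  simpa using ((hasDerivAt_id (0 : ℝ)).mul_const (v i)).const_add (q i)

theorem differentiableAt_and_fderiv_nwFrame (a : Fin 4) (q v : Coord) :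
    DifferentiableAt ℝ (nw.frame a) q ∧ fderiv ℝ (nw.frame a) q v =
      ![0, ![-Real.sin (q 2) * v 2, Real.cos (q 2) * v 2, 0,
          (-(v 1) * Real.cos (q 2) + v 0 * Real.sin (q 2)
            + v 2 * (q 1 * Real.sin (q 2) + q 0 * Real.cos (q 2))) / 2],
        ![-Real.cos (q 2) * v 2, -Real.sin (q 2) * v 2, 0,
          (v 0 * Real.cos (q 2) + v 1 * Real.sin (q 2)
            + v 2 * (-q 0 * Real.sin (q 2) + q 1 * Real.cos (q 2))) / 2], 0] a := by
  have hd : DifferentiableAt ℝ (nw.frame a) q := by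
    rw [differentiableAt_pi]
    intro i
    fin_cases a <;> fin_cases i <;> simp [nw, nwFrame, cover] <;> fun_prop
  refine ⟨hd, ?_⟩
  have hc := hasDerivAt_line_apply q v
  refine (hasDerivAt_line hd v).unique ?_
  rw [hasDerivAt_pi]
  intro i
  fin_cases a <;> fin_cases i <;> simp [nw, nwFrame, cover]
  all_goals try exact hasDerivAt_const _ _
  · refine ((hc 2).cos).congr_deriv ?_
    simp
  · refine ((hc 2).sin).congr_deriv ?_
    simp
  · refine ((((hc 1).mul (hc 2).cos).neg.add ((hc 0).mul (hc 2).sin)).div_const 2).congr_deriv ?_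
    simp; ring
  · refine ((hc 2).sin.neg).congr_deriv ?_
    simp
  · refine ((hc 2).cos).congr_deriv ?_
    simp
  · refine ((((hc 0).mul (hc 2).cos).add ((hc 1).mul (hc 2).sin)).div_const 2).congr_deriv ?_
    simp; ring

/-- The brackets of the left-invariant frame. -/
theorem lieBracket_nwFrame (a b : Fin 4) (q : Coord) :
    VectorField.lieBracket ℝ (nw.frame a) (nw.frame b) q =
      (√2)⁻¹ • (![![0, -nw.frame 2 q, nw.frame 1 q, 0],
        ![nw.frame 2 q, 0, nw.frame 0 q + nw.frame 3 q, -nw.frame 2 q],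
        ![-nw.frame 1 q, -(nw.frame 0 q + nw.frame 3 q), 0, nw.frame 1 q],
        ![0, nw.frame 2 q, -nw.frame 1 q, 0]] a b) := by
  have h2 : (√2 : ℝ)⁻¹ * (√2)⁻¹ = 1 / 2 := by
    rw [← mul_inv, Real.mul_self_sqrt (by norm_num)]; norm_num
  have hcs := Real.sin_sq_add_cos_sq (q 2)
  rw [VectorField.lieBracket, (differentiableAt_and_fderiv_nwFrame b q _).2,
    (differentiableAt_and_fderiv_nwFrame a q _).2]
  ext i
  fin_cases a <;> fin_cases b <;> fin_cases i <;> simp [nw, nwFrame, cover] <;> grind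

/-- Up to the factor `1/(2√2)`, the connection coefficients are the totally antisymmetric tensor
with components `1` at `(0,1,2)` and `-1` at `(1,2,3)`: as the metric is bi-invariant, they equal
`½ ⟨[U_μ, U_ρ], U_ν⟩`. -/
theorem nw_connection (q : Coord) (μ ν ρ : Fin 4) :
    nw.connection q μ ν ρ = (2 * √2)⁻¹ *
      (![![![0, 0, 0, 0], ![0, 0, 1, 0], ![0, -1, 0, 0], ![0, 0, 0, 0]],
        ![![0, 0, -1, 0], ![0, 0, 0, 0], ![1, 0, 0, -1], ![0, 0, 1, 0]],
        ![![0, 1, 0, 0], ![-1, 0, 0, 1], ![0, 0, 0, 0], ![0, -1, 0, 0]],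
        ![![0, 0, 0, 0], ![0, 0, -1, 0], ![0, 1, 0, 0], ![0, 0, 0, 0]]] :
        Fin 4 → Fin 4 → Fin 4 → ℝ) μ ν ρ := by
  have ho : ∀ a b, nw.metric q (nw.frame a q) (nw.frame b q) = if a = b then eta a else 0 :=
    nw.orthonormal q
  unfold FramedMetric.connection
  simp only [lieBracket_nwFrame]
  fin_cases μ <;> fin_cases ν <;> fin_cases ρ <;>
    simp [ho] <;> simp [eta] <;> ring

/-- The Clifford contraction `¼ ∑ ω_{νρ}(U_μ) γ^μ γ^ν γ^ρ`. -/
def cliffordConnection : Matrix (Fin 4) (Fin 4) ℂ :=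
  (3 / 4 * √2 * Complex.I) • !![0, 0, 0, 0; 0, 0, 0, 1; -1, 0, 0, 0; 0, 0, 0, 0]

theorem sum_connection (q : Coord) :
    (1 / 4 : ℂ) • ∑ μ, ∑ ν, ∑ ρ,
      (nw.connection q μ ν ρ : ℂ) • (gamma μ * (gamma ν * gamma ρ)) = cliffordConnection := by
  have h2 : ((√2 : ℝ) : ℂ) * ((√2 : ℝ) : ℂ) = 2 := by
    rw [← Complex.ofReal_mul, Real.mul_self_sqrt (by norm_num)]; norm_num
  have h0 : ((√2 : ℝ) : ℂ) ≠ 0 := by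
    intro h; rw [h] at h2; norm_num at h2
  simp only [nw_connection, Fin.sum_univ_four]
  simp only [Matrix.cons_val, mul_zero, mul_one, mul_neg, Complex.ofReal_zero, zero_smul, add_zero,
    zero_add, Complex.ofReal_neg, neg_smul]
  -- By antisymmetry only the products `E = γ⁰γ¹γ²` and `F = γ¹γ²γ³` occur, up to sign.
  set E : Matrix (Fin 4) (Fin 4) ℂ :=
    !![0, 0, -Complex.I, 0; 0, 0, 0, Complex.I; -Complex.I, 0, 0, 0; 0, Complex.I, 0, 0]
  set F : Matrix (Fin 4) (Fin 4) ℂ :=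
    !![0, 0, -Complex.I, 0; 0, 0, 0, -Complex.I; Complex.I, 0, 0, 0; 0, Complex.I, 0, 0]
  have hE012 : gamma 0 * (gamma 1 * gamma 2) = E := by
    simp [gamma, E]
  have hE021 : gamma 0 * (gamma 2 * gamma 1) = -E := by
    simp [gamma, E]
  have hE102 : gamma 1 * (gamma 0 * gamma 2) = -E := by
    simp [gamma, E]
  have hE120 : gamma 1 * (gamma 2 * gamma 0) = E := by
    simp [gamma, E]
  have hE201 : gamma 2 * (gamma 0 * gamma 1) = E := by
    simp [gamma, E]
  have hE210 : gamma 2 * (gamma 1 * gamma 0) = -E := by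
    simp [gamma, E]
  have hF123 : gamma 1 * (gamma 2 * gamma 3) = F := by
    simp [gamma, F]
  have hF132 : gamma 1 * (gamma 3 * gamma 2) = -F := by
    simp [gamma, F]
  have hF213 : gamma 2 * (gamma 1 * gamma 3) = -F := by
    simp [gamma, F]
  have hF231 : gamma 2 * (gamma 3 * gamma 1) = F := by
    simp [gamma, F]
  have hF312 : gamma 3 * (gamma 1 * gamma 2) = F := by
    simp [gamma, F]
  have hF321 : gamma 3 * (gamma 2 * gamma 1) = -F := by
    simp [gamma, F]
  simp only [hE012, hE021, hE102, hE120, hE201, hE210, hF123, hF132, hF213, hF231, hF312, hF321]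
  have hK : cliffordConnection = (3 / 8 * √2 : ℂ) • (E - F) := by
    ext i j
    fin_cases i <;> fin_cases j <;> simp [E, F, cliffordConnection] <;> ring
  rw [hK]
  push_cast
  match_scalars <;> field_simp <;> grind

/-! ### The Lorentz transformation and its spin lift -/

/-- The phase `exp (iα/2)`, where `α = arctan (U/2)` is half of the angle coordinate `θ`. -/
def halfPhase (u : ℝ) : ℂ := Complex.exp ((Real.arctan (u / 2) / 2 : ℝ) * Complex.I)

theorem halfPhase_ne_zero (u : ℝ) : halfPhase u ≠ 0 := Complex.exp_ne_zero _

theorem Omega_pos (p : Coord) : 0 < Omega p := by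
  unfold Omega; positivity

theorem Omega_sq (p : Coord) : Omega p ^ 2 = 1 + p 2 ^ 2 / 4 := by
  unfold Omega
  rw [div_pow, Real.sq_sqrt (by positivity)]; ring

/-- The polar form `Ω exp (iα) = 1 + iU/2`, as `Ω cos α = 1` and `Ω sin α = U/2`. -/
theorem halfPhase_sq (p : Coord) :
    (Omega p : ℂ) * halfPhase (p 2) ^ 2 = 1 + Complex.I * p 2 / 2 := by
  have h1 : √(1 + (p 2 / 2) ^ 2) = Omega p := by
    rw [Real.sqrt_eq_iff_mul_self_eq (by positivity) (Omega_pos p).le, ← sq, Omega_sq]; ring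
  have hO := (Omega_pos p).ne'
  unfold halfPhase
  rw [← Complex.exp_nat_mul]
  rw [show ((2 : ℕ) : ℂ) * ((Real.arctan (p 2 / 2) / 2 : ℝ) * Complex.I)
    = (Real.arctan (p 2 / 2) : ℝ) * Complex.I by push_cast; ring]
  rw [Complex.exp_mul_I, ← Complex.ofReal_cos, ← Complex.ofReal_sin, Real.cos_arctan,
    Real.sin_arctan, h1]
  have : (Omega p : ℂ) ≠ 0 := by exact_mod_cast hO
  push_cast
  field_simp

/-- The conjugate `Ω exp (-iα) = 1 - iU/2` of the polar form, cleared of denominators. -/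
theorem halfPhase_inv_sq (p : Coord) :
    (Omega p : ℂ) = halfPhase (p 2) ^ 2 * (1 - Complex.I * p 2 / 2) := by
  have h := halfPhase_sq p
  have hO : (Omega p : ℂ) ≠ 0 := by exact_mod_cast (Omega_pos p).ne'
  have h2 : (Omega p : ℂ) ^ 2 = 1 + (p 2 : ℂ) ^ 2 / 4 := by exact_mod_cast Omega_sq p
  refine mul_left_cancel₀ hO ?_
  linear_combination h2 - (1 - Complex.I * p 2 / 2) * h + (p 2 : ℂ) ^ 2 / 4 * Complex.I_mul_I

/-- The matrix `G` of the conformal map with respect to the two orthonormal coframes. It is the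
composition of a rotation by `α` in the `12`-plane, a boost by `Ω` in the `03`-plane, a null
rotation and the time reversal. -/
def confLorentz (p : Coord) : Matrix (Fin 4) (Fin 4) ℝ :=
  let n₁ := (p 1 + p 2 / 2 * p 0) / (2 * √2 * Omega p)
  let n₂ := (p 2 / 2 * p 1 - p 0) / (2 * √2 * Omega p)
  let k := (p 0 ^ 2 + p 1 ^ 2) / (8 * Omega p)
  let Ω := Omega p
  !![-(Ω + k + 1 / Ω) / 2, p 1 / (2 * √2 * Ω), -p 0 / (2 * √2 * Ω), (Ω + k - 1 / Ω) / 2;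
    -n₁, 1 / Ω, -p 2 / (2 * Ω), n₁;
    -n₂, p 2 / (2 * Ω), 1 / Ω, n₂;
    -(Ω - k - 1 / Ω) / 2, -p 1 / (2 * √2 * Ω), p 0 / (2 * √2 * Ω), (Ω - k + 1 / Ω) / 2]

theorem confLorentz_isLorentz (p : Coord) : IsLorentz (confLorentz p) := by
  have h2 : √2 * √2 = (2 : ℝ) := Real.mul_self_sqrt (by norm_num)
  have h0 : (√2 : ℝ) ≠ 0 := by positivity
  have hO := (Omega_pos p).ne'
  have hO2 := Omega_sq p
  unfold IsLorentz
  ext i j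
  fin_cases i <;> fin_cases j <;>
    simp [confLorentz, Matrix.mul_apply, Fin.sum_univ_four, eta, Matrix.diagonal_apply] <;>
    field_simp <;> grind

/-- A spin lift of `confLorentz`: the product of a rotation by the half-angle `α/2`, a boost with
eigenvalues `√Ω` and `1/√Ω`, a null rotation which is affine in `X₁, X₂`, and `γ¹γ²γ³`. -/
def confSpin (p : Coord) : Matrix (Fin 4) (Fin 4) ℂ :=
  let P : ℂ := (√(Omega p) : ℝ)
  let w := halfPhase (p 2)
  let κ : ℂ := (2 * √2 : ℝ)⁻¹
  !![0, 0, -Complex.I * w⁻¹ * P⁻¹, -κ * (p 0 - p 1 * Complex.I) * w⁻¹ * P⁻¹;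
    0, 0, 0, -Complex.I * w * P;
    Complex.I * w⁻¹ * P, 0, 0, 0;
    κ * (p 0 + p 1 * Complex.I) * w * P⁻¹, Complex.I * w * P⁻¹, 0, 0]

/-- Clifford multiplication by a (complex) covector, in block form. -/
theorem sum_smul_gamma (v : Fin 4 → ℂ) :
    ∑ a, v a • gamma a = !![0, 0, v 0 + v 3, v 1 - Complex.I * v 2;
      0, 0, v 1 + Complex.I * v 2, v 0 - v 3;
      v 0 - v 3, -v 1 + Complex.I * v 2, 0, 0;
      -v 1 - Complex.I * v 2, v 0 + v 3, 0, 0] := by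
  rw [Fin.sum_univ_four]
  ext i j
  fin_cases i <;> fin_cases j <;> simp [gamma] <;> ring

theorem confSpin_det (p : Coord) : (confSpin p).det = 1 := by
  have hP : ((√(Omega p) : ℝ) : ℂ) ≠ 0 := by
    exact_mod_cast (Real.sqrt_pos.2 (Omega_pos p)).ne'
  have hw := halfPhase_ne_zero (p 2)
  have hI := Complex.I_mul_I
  simp [Matrix.det_succ_row_zero, Fin.sum_univ_succ, confSpin, Fin.succAbove, Matrix.submatrix]
  field_simp
  grind

/-- The lifting property `S⁻¹ γᵃ S = Gᵃ_b γᵇ`, without inverses. -/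
theorem gamma_mul_confSpin (p : Coord) (a : Fin 4) :
    gamma a * confSpin p = confSpin p * ∑ b, (confLorentz p a b : ℂ) • gamma b := by
  have hP : ((√(Omega p) : ℝ) : ℂ) ≠ 0 := by
    exact_mod_cast (Real.sqrt_pos.2 (Omega_pos p)).ne'
  have hw := halfPhase_ne_zero (p 2)
  have hI := Complex.I_mul_I
  have hO : (Omega p : ℂ) = ((√(Omega p) : ℝ) : ℂ) ^ 2 := by
    norm_cast; rw [Real.sq_sqrt (Omega_pos p).le]
  have h2 : ((√2 : ℝ) : ℂ) * ((√2 : ℝ) : ℂ) = 2 := by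
    rw [← Complex.ofReal_mul, Real.mul_self_sqrt (by norm_num)]; norm_num
  have h0 : ((√2 : ℝ) : ℂ) ≠ 0 := by
    intro h; rw [h] at h2; norm_num at h2
  have hs := halfPhase_sq p
  have hs' := halfPhase_inv_sq p
  rw [sum_smul_gamma fun b => (confLorentz p a b : ℂ)]
  rw [hO] at hs hs'
  simp only [confSpin, confLorentz]
  set P : ℂ := ((√(Omega p) : ℝ) : ℂ)
  set w := halfPhase (p 2)
  fin_cases a
  all_goals
    simp [gamma, hO]
    constructorm* _ ∧ _
  all_goals field_simp
  all_goals grind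

theorem confLorentz_spin (p : Coord) (a : Fin 4) :
    (confSpin p)⁻¹ * gamma a * confSpin p = ∑ b, (confLorentz p a b : ℂ) • gamma b := by
  rw [mul_assoc, gamma_mul_confSpin, ← mul_assoc, Matrix.nonsing_inv_mul _ (by simp [confSpin_det]),
    one_mul]

theorem continuous_confSpin : Continuous confSpin := by
  have hΩ : Continuous Omega := by unfold Omega; fun_prop
  have hP : Continuous fun p => ((√(Omega p) : ℝ) : ℂ) := by fun_prop
  have hPi : Continuous fun p => ((√(Omega p) : ℝ) : ℂ)⁻¹ :=
    hP.inv₀ fun p => by exact_mod_cast (Real.sqrt_pos.2 (Omega_pos p)).ne'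
  have hw : Continuous fun p : Coord => halfPhase (p 2) := by
    unfold halfPhase
    have := Real.continuous_arctan
    fun_prop
  have hwi : Continuous fun p : Coord => (halfPhase (p 2))⁻¹ :=
    hw.inv₀ fun p => halfPhase_ne_zero _
  refine continuous_matrix fun i j => ?_
  fin_cases i <;> fin_cases j <;> simp [confSpin] <;> fun_prop

/-- Elements of the pin group have determinant one, since a unit vector squares to `∓1`. -/
theorem det_of_mem_Pin13 {M : Matrix (Fin 4) (Fin 4) ℂ} (hM : M ∈ Pin13) : M.det = 1 := by
  induction hM using Submonoid.closure_induction with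
  | mem x hx =>
    obtain ⟨v, hv, rfl⟩ := hx
    have hI := Complex.I_mul_I
    have h : ((v 0 : ℂ) ^ 2 - v 1 ^ 2 - v 2 ^ 2 - v 3 ^ 2) ^ 2 = 1 := by
      have : (v 0 ^ 2 - v 1 ^ 2 - v 2 ^ 2 - v 3 ^ 2) ^ 2 = 1 := by
        simp [Fin.sum_univ_four, eta] at hv
        grind
      exact_mod_cast this
    rw [sum_smul_gamma fun a => (v a : ℂ)]
    simp [Matrix.det_succ_row_zero, Fin.sum_univ_succ, Fin.succAbove, Matrix.submatrix]
    grind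
  | one => simp
  | mul x y _ _ hx hy => rw [Matrix.det_mul, hx, hy, one_mul]

/-- Clifford multiplication by a real vector, given by its components. -/
def clifford (a b c d : ℝ) : Matrix (Fin 4) (Fin 4) ℂ :=
  !![0, 0, a + d, b - Complex.I * c;
    0, 0, b + Complex.I * c, a - d;
    a - d, -b + Complex.I * c, 0, 0;
    -b - Complex.I * c, a + d, 0, 0]

theorem clifford_mem_Pin13 {a b c d : ℝ} (h : -a ^ 2 + b ^ 2 + c ^ 2 + d ^ 2 = 1 ∨
    -a ^ 2 + b ^ 2 + c ^ 2 + d ^ 2 = -1) : clifford a b c d ∈ Pin13 := by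
  refine Submonoid.subset_closure ⟨![a, b, c, d], ?_, ?_⟩
  · simpa [Fin.sum_univ_four, eta] using h
  · rw [sum_smul_gamma fun i => ((![a, b, c, d] i : ℝ) : ℂ)]
    simp [clifford]

/-- A rotation in the `12`-plane, as a product of two unit vectors. -/
theorem rotation_mem_Pin13 (u : ℝ) :
    !![(halfPhase u)⁻¹, 0, 0, 0; 0, halfPhase u, 0, 0; 0, 0, (halfPhase u)⁻¹, 0;
      0, 0, 0, halfPhase u] ∈ Pin13 := by
  have hI := Complex.I_mul_I
  have hw : halfPhase u = Complex.cos ((Real.arctan (u / 2) / 2 : ℝ) : ℂ)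
      + Complex.sin ((Real.arctan (u / 2) / 2 : ℝ) : ℂ) * Complex.I := by
    rw [halfPhase, Complex.exp_mul_I]
  set β := Real.arctan (u / 2) / 2
  have hcs := Complex.sin_sq_add_cos_sq β
  have hwi : (halfPhase u)⁻¹ = Complex.cos β - Complex.sin β * Complex.I :=
    inv_eq_of_mul_eq_one_right (by rw [hw]; grind)
  have h : !![(halfPhase u)⁻¹, 0, 0, 0; 0, halfPhase u, 0, 0; 0, 0, (halfPhase u)⁻¹, 0;
      0, 0, 0, halfPhase u]
      = clifford 0 1 0 0 * clifford 0 (-Real.cos β) (Real.sin β) 0 := by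
    rw [hwi, hw]
    ext i j
    fin_cases i <;> fin_cases j <;> simp [clifford] <;> ring
  rw [h]
  exact mul_mem (clifford_mem_Pin13 (by norm_num)) (clifford_mem_Pin13 (by norm_num))

/-- A boost in the `03`-plane, as a product of two unit vectors. -/
theorem boost_mem_Pin13 {P : ℝ} (hP : P ≠ 0) :
    !![(P : ℂ)⁻¹, 0, 0, 0; 0, P, 0, 0; 0, 0, P, 0; 0, 0, 0, (P : ℂ)⁻¹] ∈ Pin13 := by
  -- For `P = exp η`, the second unit vector is `(cosh η, 0, 0, sinh η)`.
  have h : !![(P : ℂ)⁻¹, 0, 0, 0; 0, P, 0, 0; 0, 0, P, 0; 0, 0, 0, (P : ℂ)⁻¹]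
      = clifford 1 0 0 0 * clifford ((P + P⁻¹) / 2) 0 0 ((P - P⁻¹) / 2) := by
    ext i j
    fin_cases i <;> fin_cases j <;> simp [clifford] <;> ring
  rw [h]
  refine mul_mem (clifford_mem_Pin13 (by norm_num)) (clifford_mem_Pin13 (Or.inr ?_))
  field_simp
  ring

/-- A null rotation, as a product of four unit vectors. -/
theorem nullRotation_mem_Pin13 (a b : ℝ) :
    !![1, -2 * (a + b * Complex.I), 0, 0; 0, 1, 0, 0; 0, 0, 1, 0;
      0, 0, 2 * (a - b * Complex.I), 1] ∈ Pin13 := by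
  have h₁ : clifford a (-1) 0 a * clifford 0 1 0 0
      = !![1, -2 * (a : ℂ), 0, 0; 0, 1, 0, 0; 0, 0, 1, 0; 0, 0, 2 * (a : ℂ), 1] := by
    ext i j
    fin_cases i <;> fin_cases j <;> simp [clifford] <;> ring_nf
  have h₂ : clifford (-b) 0 (-1) (-b) * clifford 0 0 1 0
      = !![1, -2 * b * Complex.I, 0, 0; 0, 1, 0, 0; 0, 0, 1, 0; 0, 0, -2 * b * Complex.I, 1] := by
    ext i j
    fin_cases i <;> fin_cases j <;> simp [clifford] <;> ring_nf
  have h : !![1, -2 * (a + b * Complex.I), 0, 0; 0, 1, 0, 0; 0, 0, 1, 0;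
      0, 0, 2 * (a - b * Complex.I), 1] = clifford a (-1) 0 a * clifford 0 1 0 0
        * (clifford (-b) 0 (-1) (-b) * clifford 0 0 1 0) := by
    rw [h₁, h₂]
    ext i j
    fin_cases i <;> fin_cases j <;> simp <;> ring
  rw [h]
  refine mul_mem (mul_mem ?_ ?_) (mul_mem ?_ ?_) <;>
    exact clifford_mem_Pin13 (Or.inl (by ring))

/-- The product `γ¹γ²γ³`, which covers the time reversal. -/
theorem timeReversal_mem_Pin13 :
    !![0, 0, -Complex.I, 0; 0, 0, 0, -Complex.I; Complex.I, 0, 0, 0; 0, Complex.I, 0, 0]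
      ∈ Pin13 := by
  have h : !![0, 0, -Complex.I, 0; 0, 0, 0, -Complex.I; Complex.I, 0, 0, 0; 0, Complex.I, 0, 0]
      = clifford 0 1 0 0 * (clifford 0 0 1 0 * clifford 0 0 0 1) := by
    ext i j
    fin_cases i <;> fin_cases j <;> simp [clifford]
  rw [h]
  refine mul_mem ?_ (mul_mem ?_ ?_) <;> exact clifford_mem_Pin13 (by norm_num)

theorem confSpin_mem_Pin13 (p : Coord) : confSpin p ∈ Pin13 := by
  have hP0 := (Real.sqrt_pos.2 (Omega_pos p)).ne'
  have hI := Complex.I_mul_I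
  have key := mul_mem (mul_mem (rotation_mem_Pin13 (p 2)) (boost_mem_Pin13 hP0)) <|
    mul_mem (nullRotation_mem_Pin13 ((4 * √2)⁻¹ * p 1) ((4 * √2)⁻¹ * p 0)) timeReversal_mem_Pin13
  convert key using 1
  simp only [confSpin]
  generalize (√(Omega p) : ℝ) = P
  generalize halfPhase (p 2) = w
  ext i j
  fin_cases i <;> fin_cases j <;> simp <;> grind

/-! ### The differential of the conformal map -/

theorem contDiff_HCoord : ContDiff ℝ ∞ HCoord := by
  rw [contDiff_pi]
  have h (p : Coord) : 4 + p 2 ^ 2 ≠ 0 := by positivity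
  have h' (p : Coord) : 2 * (4 + p 2 ^ 2) ≠ 0 := by positivity
  have := Real.contDiff_arctan (n := ∞)
  intro i
  fin_cases i <;> simp only [HCoord] <;> simp <;> fun_prop (disch := assumption)

theorem fderiv_HCoord (p v : Coord) :
    fderiv ℝ HCoord p v =
      ![(2 * (2 * v 0 - (v 2 * p 1 + p 2 * v 1)) * (4 + p 2 ^ 2)
          - 2 * (2 * p 0 - p 2 * p 1) * (2 * p 2 * v 2)) / (4 + p 2 ^ 2) ^ 2,
        (2 * (v 2 * p 0 + p 2 * v 0 + 2 * v 1) * (4 + p 2 ^ 2)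
          - 2 * (p 2 * p 0 + 2 * p 1) * (2 * p 2 * v 2)) / (4 + p 2 ^ 2) ^ 2,
        4 * v 2 / (4 + p 2 ^ 2),
        -v 3 + ((v 2 * (p 0 ^ 2 + p 1 ^ 2) + p 2 * (2 * p 0 * v 0 + 2 * p 1 * v 1))
            * (2 * (4 + p 2 ^ 2))
          - p 2 * (p 0 ^ 2 + p 1 ^ 2) * (2 * (2 * p 2 * v 2))) / (2 * (4 + p 2 ^ 2)) ^ 2] := by
  refine (hasDerivAt_line (contDiff_HCoord.differentiable (by simp) p) v).unique ?_
  have hc := hasDerivAt_line_apply p v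
  have hD : HasDerivAt (fun s : ℝ => 4 + (p 2 + s * v 2) ^ 2) (2 * p 2 * v 2) 0 := by
    simpa using ((hc 2).pow 2).const_add 4
  have h0 : 4 + (p 2 + 0 * v 2) ^ 2 ≠ 0 := by positivity
  have h1 : 2 * (4 + (p 2 + 0 * v 2) ^ 2) ≠ 0 := by positivity
  rw [hasDerivAt_pi]
  intro i
  fin_cases i <;> simp [HCoord]
  · refine (((((hc 0).const_mul 2).sub ((hc 2).mul (hc 1))).const_mul 2).div hD h0).congr_deriv ?_
    simp
  · refine (((((hc 2).mul (hc 0)).add ((hc 1).const_mul 2)).const_mul 2).div hD h0).congr_deriv ?_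
    simp
  · refine (((hc 2).div_const 2).arctan.const_mul 2).congr_deriv ?_
    simp; field_simp; ring
  · have h3 : HasDerivAt (fun s : ℝ => -(s * v 3) + -p 3) (-v 3) 0 :=
      (hc 3).neg.congr_of_eventuallyEq (.of_forall fun s => by simp)
    refine (h3.add (((hc 2).mul (((hc 0).pow 2).add ((hc 1).pow 2))).div
      (hD.const_mul 2) h1)).congr_deriv ?_
    simp

theorem cos_two_arctan_half (u : ℝ) :
    Real.cos (2 * Real.arctan (u / 2)) = (4 - u ^ 2) / (4 + u ^ 2) := by
  have h : 1 + (u / 2) ^ 2 ≠ 0 := by positivity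
  rw [Real.cos_two_mul, Real.cos_sq_arctan]
  field_simp
  ring

theorem sin_two_arctan_half (u : ℝ) :
    Real.sin (2 * Real.arctan (u / 2)) = 4 * u / (4 + u ^ 2) := by
  have h : √(1 + (u / 2) ^ 2) ^ 2 = 1 + (u / 2) ^ 2 := Real.sq_sqrt (by positivity)
  have h' : √(1 + (u / 2) ^ 2) ≠ 0 := by positivity
  rw [Real.sin_two_mul, Real.sin_arctan, Real.cos_arctan]
  have h1 : 4 + u ^ 2 ≠ 0 := by positivity
  generalize √(1 + (u / 2) ^ 2) = s at h h'
  field_simp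
  rw [h]
  ring

theorem relatesCoframes_confLorentz : RelatesCoframes confLorentz := by
  intro p a v
  have h2 : √2 * √2 = (2 : ℝ) := Real.mul_self_sqrt (by norm_num)
  have h0 : (√2 : ℝ) ≠ 0 := by positivity
  have hO := (Omega_pos p).ne'
  have hO2 : 4 + p 2 ^ 2 = 4 * Omega p ^ 2 := by rw [Omega_sq]; ring
  rw [fderiv_HCoord]
  fin_cases a <;>
  simp [FramedMetric.coframe, mink, nw, minkMetric, minkFrame, nwMetric, nwFrame, cover, eta,
    Matrix.toBilin'_apply', dotProduct, Matrix.mulVec, Fin.sum_univ_four, confLorentz, HCoord,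
    cos_two_arctan_half, sin_two_arctan_half, hO2] <;> field_simp <;> grind

/-- A vector is the combination of the frame with its coframe components. -/
theorem sum_nw_coframe (q v : Coord) : ∑ b, nw.coframe b q v • nw.frame b q = v := by
  have h2 : (√2 : ℝ)⁻¹ * (√2)⁻¹ = 1 / 2 := by
    rw [← mul_inv, Real.mul_self_sqrt (by norm_num)]; norm_num
  have hcs := Real.sin_sq_add_cos_sq (q 2)
  ext i
  fin_cases i <;>
  simp [FramedMetric.coframe, nw, nwMetric, nwFrame, cover, eta,
    Matrix.toBilin'_apply', dotProduct, Matrix.mulVec, Fin.sum_univ_four] <;> grind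

/-- The matrix of the differential of the conformal map in the two frames. -/
def diffH (p : Coord) : Matrix (Fin 4) (Fin 4) ℝ :=
  Matrix.of fun b c => nw.coframe b (HCoord p) (fderiv ℝ HCoord p (mink.frame c p))

theorem mink_coframe_frame (p : Coord) (a c : Fin 4) :
    mink.coframe a p (mink.frame c p) = (1 : Matrix (Fin 4) (Fin 4) ℝ) a c := by
  rw [FramedMetric.coframe, mink.orthonormal, Matrix.one_apply]
  split_ifs with h
  · fin_cases a <;> simp [eta]
  · simp

/-- Evaluating the coframe relation on the frame `(e_c)`: `ΩG` is the inverse of the differential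
of `H`, which gives the uniqueness of `G`. -/
theorem RelatesCoframes.smul_mul_diffH {G : Coord → Matrix (Fin 4) (Fin 4) ℝ}
    (hG : RelatesCoframes G) (p : Coord) : Omega p • G p * diffH p = 1 := by
  ext a c
  rw [← mink_coframe_frame p, hG p a]
  simp [Matrix.mul_apply, diffH, Finset.mul_sum, mul_assoc]

theorem RelatesCoframes.diffH_mul_smul {G : Coord → Matrix (Fin 4) (Fin 4) ℝ}
    (hG : RelatesCoframes G) (p : Coord) : diffH p * Omega p • G p = 1 :=
  mul_eq_one_comm.1 (hG.smul_mul_diffH p)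

theorem RelatesCoframes.unique {G G' : Coord → Matrix (Fin 4) (Fin 4) ℝ}
    (hG : RelatesCoframes G) (hG' : RelatesCoframes G') : G = G' := by
  funext p
  have h : Omega p • G p = Omega p • G' p :=
    left_inv_eq_right_inv (hG.smul_mul_diffH p) (hG'.diffH_mul_smul p)
  exact smul_right_injective _ (Omega_pos p).ne' h

/-! ### Conformal covariance of the Dirac operator -/

/-- The spin lift with its conformal weight, `Ω^(-3/2) S`. -/
def weightedSpin (p : Coord) : Matrix (Fin 4) (Fin 4) ℂ :=
  ((Omega p ^ (-(3 / 2) : ℝ) : ℝ) : ℂ) • confSpin p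

/-- The matrix entries of `Ω^(-3/2) S`; the weight turns the square roots `Ω^(±1/2)` in `S` into
`Ω⁻¹` and `Ω⁻²`. -/
theorem weightedSpin_eq (p : Coord) : weightedSpin p =
    let κ : ℂ := (2 * √2 : ℝ)⁻¹
    let w := halfPhase (p 2)
    let Ω : ℂ := Omega p
    !![0, 0, -Complex.I * (w⁻¹ / Ω ^ 2), -κ * ((p 0 - p 1 * Complex.I) * (w⁻¹ / Ω ^ 2));
      0, 0, 0, -Complex.I * (w / Ω);
      Complex.I * (w⁻¹ / Ω), 0, 0, 0;
      κ * ((p 0 + p 1 * Complex.I) * (w / Ω ^ 2)), Complex.I * (w / Ω ^ 2), 0, 0] := by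
  have hΩ := Omega_pos p
  have hP : ((√(Omega p) : ℝ) : ℂ) ≠ 0 := by exact_mod_cast (Real.sqrt_pos.2 hΩ).ne'
  have h1 : ((Omega p ^ (-(3 / 2) : ℝ) : ℝ) : ℂ) = (((√(Omega p) : ℝ) : ℂ) ^ 3)⁻¹ := by
    norm_cast
    rw [Real.rpow_neg hΩ.le, Real.sqrt_eq_rpow, ← Real.rpow_mul_natCast hΩ.le]
    norm_num
  have h2 : (Omega p : ℂ) = ((√(Omega p) : ℝ) : ℂ) ^ 2 := by
    norm_cast; rw [Real.sq_sqrt hΩ.le]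
  have hw := halfPhase_ne_zero (p 2)
  rw [weightedSpin, confSpin, h1, h2]
  ext i j
  fin_cases i <;> fin_cases j <;> simp <;> field_simp

theorem contDiff_Omega : ContDiff ℝ ∞ Omega := by
  unfold Omega
  have h (p : Coord) : 4 + p 2 ^ 2 ≠ 0 := by positivity
  fun_prop (disch := assumption)

theorem contDiff_halfPhase : ContDiff ℝ ∞ halfPhase := by
  unfold halfPhase
  have := Real.contDiff_arctan (n := ∞)
  have h : ContDiff ℝ ∞ fun u : ℝ => ((Real.arctan (u / 2) / 2 : ℝ) : ℂ) :=
    Complex.ofRealCLM.contDiff.comp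
      ((this.comp (contDiff_id.div_const 2)).div_const 2)
  exact (h.mul contDiff_const).cexp

theorem contDiff_weightedSpin (i j : Fin 4) : ContDiff ℝ ∞ fun p => weightedSpin p i j := by
  have hr (k : Fin 4) : ContDiff ℝ ∞ fun p : Coord => (p k : ℂ) :=
    Complex.ofRealCLM.contDiff.comp (contDiff_apply ℝ ℝ k)
  have h0 := hr 0
  have h1 := hr 1
  have hO : ContDiff ℝ ∞ fun p => (Omega p : ℂ) := Complex.ofRealCLM.contDiff.comp contDiff_Omega
  have hO0 (p : Coord) : (Omega p : ℂ) ≠ 0 := by exact_mod_cast (Omega_pos p).ne'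
  have hOi : ContDiff ℝ ∞ fun p => (Omega p : ℂ)⁻¹ := hO.inv hO0
  have hw : ContDiff ℝ ∞ fun p : Coord => halfPhase (p 2) :=
    contDiff_halfPhase.comp (contDiff_apply ℝ ℝ 2)
  have hwi : ContDiff ℝ ∞ fun p : Coord => (halfPhase (p 2))⁻¹ :=
    hw.inv fun p => halfPhase_ne_zero _
  simp only [weightedSpin_eq]
  fin_cases i <;> fin_cases j <;> simp [div_eq_mul_inv, -mul_eq_mul_left_iff] <;>
    (try simp only [← inv_pow]) <;> fun_prop

theorem hasDerivAt_Omega_line (p v : Coord) :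
    HasDerivAt (fun s : ℝ => Omega (p + s • v)) (p 2 * v 2 / (4 * Omega p)) 0 := by
  have hc := hasDerivAt_line_apply p v 2
  have h := (((hc.fun_pow 2).const_add 4).sqrt (by positivity)).div_const 2
  refine h.congr_deriv ?_
  simp [Omega]
  have : √(4 + p 2 ^ 2) ≠ 0 := by positivity
  field_simp
  ring

theorem hasDerivAt_halfPhase_line (p v : Coord) :
    HasDerivAt (fun s : ℝ => halfPhase ((p + s • v) 2))
      (Complex.I * halfPhase (p 2) * v 2 / (4 * Omega p ^ 2)) 0 := by
  have hc := hasDerivAt_line_apply p v 2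
  have h := ((((hc.div_const 2).arctan).div_const 2).ofReal_comp.mul_const Complex.I).cexp
  have hO := Omega_sq p
  have hO' : (Omega p : ℂ) ^ 2 = 1 + (p 2 : ℂ) ^ 2 / 4 := by exact_mod_cast hO
  have h0 : (4 + (p 2 : ℂ) ^ 2) ≠ 0 := by
    have : 4 + p 2 ^ 2 ≠ 0 := by positivity
    exact_mod_cast this
  refine h.congr_deriv ?_
  rw [hO']
  simp [halfPhase]
  have h1 : 1 + ((p 2 : ℂ) / 2) ^ 2 ≠ 0 := by
    intro h; apply h0; linear_combination 4 * h
  have h2 : 1 + ((p 2 : ℂ)) ^ 2 / 4 ≠ 0 := by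
    intro h; apply h0; linear_combination 4 * h
  field_simp
  grind

/-- The directional derivative of `weightedSpin`. -/
def weightedSpinDeriv (p v : Coord) : Matrix (Fin 4) (Fin 4) ℂ :=
  let κ : ℂ := (2 * √2 : ℝ)⁻¹
  let w := halfPhase (p 2)
  let Ω : ℂ := Omega p
  let b₀ := -(2 * p 2 + Complex.I) * v 2 / (4 * Ω ^ 2) * (w⁻¹ / Ω ^ 2)
  let b₁ := (-p 2 + Complex.I) * v 2 / (4 * Ω ^ 2) * (w / Ω)
  let b₂ := -(p 2 + Complex.I) * v 2 / (4 * Ω ^ 2) * (w⁻¹ / Ω)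
  let b₃ := (-2 * p 2 + Complex.I) * v 2 / (4 * Ω ^ 2) * (w / Ω ^ 2)
  !![0, 0, -Complex.I * b₀,
      -κ * ((v 0 - v 1 * Complex.I) * (w⁻¹ / Ω ^ 2) + (p 0 - p 1 * Complex.I) * b₀);
    0, 0, 0, -Complex.I * b₁;
    Complex.I * b₂, 0, 0, 0;
    κ * ((v 0 + v 1 * Complex.I) * (w / Ω ^ 2) + (p 0 + p 1 * Complex.I) * b₃),
      Complex.I * b₃, 0, 0]

theorem hasDerivAt_weightedSpin_line (p v : Coord) (i j : Fin 4) :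
    HasDerivAt (fun s : ℝ => weightedSpin (p + s • v) i j) (weightedSpinDeriv p v i j) 0 := by
  have hO := (hasDerivAt_Omega_line p v).ofReal_comp
  have hw := hasDerivAt_halfPhase_line p v
  have hx := (hasDerivAt_line_apply p v 0).ofReal_comp
  have hy := ((hasDerivAt_line_apply p v 1).ofReal_comp).mul_const Complex.I
  have hO0 : ((Omega (p + (0 : ℝ) • v) : ℝ) : ℂ) ≠ 0 := by exact_mod_cast (Omega_pos _).ne'
  have hO0' : ((Omega p : ℝ) : ℂ) ≠ 0 := by exact_mod_cast (Omega_pos _).ne'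
  have hw0 : halfPhase ((p + (0 : ℝ) • v) 2) ≠ 0 := halfPhase_ne_zero _
  have hw0' : halfPhase (p 2) ≠ 0 := halfPhase_ne_zero _
  have h₀ : HasDerivAt (fun s : ℝ => (halfPhase (p 2 + s * v 2))⁻¹ / (Omega (p + s • v) : ℂ) ^ 2)
      ((-Complex.I + -(2 * (p 2 : ℂ))) * v 2 / (4 * (Omega p : ℂ) ^ 2)
        * ((halfPhase (p 2))⁻¹ / (Omega p : ℂ) ^ 2)) 0 := by
    refine ((hw.fun_inv hw0).fun_div (hO.fun_pow 2) (pow_ne_zero 2 hO0)).congr_deriv ?_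
    simp
    field_simp
    ring
  have h₁ : HasDerivAt (fun s : ℝ => halfPhase (p 2 + s * v 2) / (Omega (p + s • v) : ℂ))
      ((-(p 2 : ℂ) + Complex.I) * v 2 / (4 * (Omega p : ℂ) ^ 2)
        * (halfPhase (p 2) / (Omega p : ℂ))) 0 := by
    refine (hw.fun_div hO hO0).congr_deriv ?_
    simp
    field_simp
    ring
  have h₂ : HasDerivAt (fun s : ℝ => (halfPhase (p 2 + s * v 2))⁻¹ / (Omega (p + s • v) : ℂ))
      ((-Complex.I + -(p 2 : ℂ)) * v 2 / (4 * (Omega p : ℂ) ^ 2)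
        * ((halfPhase (p 2))⁻¹ / (Omega p : ℂ))) 0 := by
    refine ((hw.fun_inv hw0).fun_div hO hO0).congr_deriv ?_
    simp
    field_simp
    ring
  have h₃ : HasDerivAt (fun s : ℝ => halfPhase (p 2 + s * v 2) / (Omega (p + s • v) : ℂ) ^ 2)
      ((-(2 * (p 2 : ℂ)) + Complex.I) * v 2 / (4 * (Omega p : ℂ) ^ 2)
        * (halfPhase (p 2) / (Omega p : ℂ) ^ 2)) 0 := by
    refine (hw.fun_div (hO.fun_pow 2) (pow_ne_zero 2 hO0)).congr_deriv ?_
    simp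
    field_simp
    ring
  have hκ := (hx.fun_sub hy).fun_mul h₀
  have hκ' := (hx.fun_add hy).fun_mul h₃
  simp only [weightedSpin_eq]
  fin_cases i <;> fin_cases j <;> simp [weightedSpinDeriv, -mul_eq_mul_left_iff]
  all_goals try exact hasDerivAt_const _ _
  · exact (h₀.const_mul Complex.I).fun_neg
  · have h := (hκ.const_mul ((√2 : ℂ)⁻¹ * 2⁻¹)).fun_neg
    simpa [-mul_eq_mul_left_iff] using h
  · exact (h₁.const_mul Complex.I).fun_neg
  · exact h₂.const_mul Complex.I
  · have h := hκ'.const_mul ((√2 : ℂ)⁻¹ * 2⁻¹)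
    simpa [-mul_eq_mul_left_iff] using h
  · exact h₃.const_mul Complex.I

/-- The flat Dirac operator applied to the matrix `Ω^(-3/2) S` reproduces the connection term of
`𝒩`: this identity fixes the weight `-3/2`. -/
theorem sum_gamma_weightedSpinDeriv (p : Coord) :
    ∑ c, gamma c * weightedSpinDeriv p (mink.frame c p)
      = -((Omega p : ℂ)⁻¹ • (weightedSpin p * cliffordConnection)) := by
  have hw := halfPhase_ne_zero (p 2)
  have hI := Complex.I_mul_I
  have h2 : ((√2 : ℝ) : ℂ) * ((√2 : ℝ) : ℂ) = 2 := by
    rw [← Complex.ofReal_mul, Real.mul_self_sqrt (by norm_num)]; norm_num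
  have h0 : ((√2 : ℝ) : ℂ) ≠ 0 := by
    intro h; rw [h] at h2; norm_num at h2
  have hs := halfPhase_sq p
  have hs' := halfPhase_inv_sq p
  have hO0' : ((Omega p : ℝ) : ℂ) ≠ 0 := by exact_mod_cast (Omega_pos _).ne'
  rw [weightedSpin_eq, Fin.sum_univ_four]
  simp only [weightedSpinDeriv, mink, minkFrame, gamma, cliffordConnection]
  ext i j
  fin_cases i <;> fin_cases j <;> simp <;> try field_simp
  all_goals grind

theorem mink_connection (p : Coord) (μ ν ρ : Fin 4) : mink.connection p μ ν ρ = 0 := by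
  have h (a b : Fin 4) : VectorField.lieBracket ℝ (mink.frame a) (mink.frame b) p = 0 := by
    have hf (c : Fin 4) : mink.frame c = fun _ => minkFrame c := rfl
    simp [VectorField.lieBracket, hf]
  simp [FramedMetric.connection, h]

/-- The frame of Minkowski space is constant, so that its spin connection vanishes. -/
theorem mink_dirac (A : Coord → Coord →L[ℝ] ℝ) (Φ : Coord → Spinor) (p : Coord) :
    mink.dirac A Φ p = ∑ c, gamma c *ᵥ (fderiv ℝ Φ p (mink.frame c p)
      + (Complex.I * (A p (mink.frame c p) : ℂ)) • Φ p) := by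
  simp [FramedMetric.dirac, FramedMetric.covDeriv, mink_connection]

theorem nw_dirac (A : Coord → Coord →L[ℝ] ℝ) (ψ : Coord → Spinor) (q : Coord) :
    nw.dirac A ψ q = ∑ b, gamma b *ᵥ (fderiv ℝ ψ q (nw.frame b q)
      + (Complex.I * (A q (nw.frame b q) : ℂ)) • ψ q) - cliffordConnection *ᵥ ψ q := by
  rw [← sum_connection q]
  simp only [FramedMetric.dirac, FramedMetric.covDeriv, Matrix.mulVec_sub, Finset.sum_sub_distrib,
    Matrix.smul_mulVec, Matrix.mulVec_smul, Matrix.sum_mulVec, Matrix.mulVec_sum,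
    Matrix.mulVec_mulVec, Finset.smul_sum]

theorem contDiff_weightedSpin_mulVec {ψ : Coord → Spinor} (hψ : ContDiff ℝ ∞ ψ) :
    ContDiff ℝ ∞ fun p => weightedSpin p *ᵥ ψ (HCoord p) := by
  rw [contDiff_pi]
  intro i
  simp only [Matrix.mulVec, dotProduct]
  refine ContDiff.sum fun j _ => (contDiff_weightedSpin i j).mul ?_
  exact ((contDiff_pi.1 hψ) j).comp contDiff_HCoord

theorem fderiv_weightedSpin_mulVec {ψ : Coord → Spinor} (hψ : ContDiff ℝ ∞ ψ) (p v : Coord) :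
    fderiv ℝ (fun p => weightedSpin p *ᵥ ψ (HCoord p)) p v =
      weightedSpinDeriv p v *ᵥ ψ (HCoord p)
        + weightedSpin p *ᵥ fderiv ℝ ψ (HCoord p) (fderiv ℝ HCoord p v) := by
  have hd := (contDiff_weightedSpin_mulVec hψ).differentiable (by simp) p
  have hH := contDiff_HCoord.differentiable (by simp) p
  have hψd := hψ.differentiable (by simp) (HCoord p)
  have hc : HasDerivAt (fun s : ℝ => ψ (HCoord (p + s • v)))
      (fderiv ℝ ψ (HCoord p) (fderiv ℝ HCoord p v)) 0 := by
    have h := hasDerivAt_line (hψd.comp p hH) v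
    rw [fderiv_comp p hψd hH] at h
    exact h
  refine (hasDerivAt_line hd v).unique ?_
  rw [hasDerivAt_pi]
  intro i
  have h := HasDerivAt.fun_sum (u := Finset.univ) fun j _ =>
    (hasDerivAt_weightedSpin_line p v i j).fun_mul (hasDerivAt_pi.1 hc j)
  refine h.congr_deriv ?_
  simp [Matrix.mulVec, dotProduct, Finset.sum_add_distrib]

theorem gamma_mul_weightedSpin (p : Coord) (a : Fin 4) :
    gamma a * weightedSpin p = weightedSpin p * ∑ b, (confLorentz p a b : ℂ) • gamma b := by
  rw [weightedSpin, Matrix.mul_smul, gamma_mul_confSpin, Matrix.smul_mul]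

theorem fderiv_HCoord_frame (p : Coord) (c : Fin 4) :
    fderiv ℝ HCoord p (mink.frame c p) = ∑ b, diffH p b c • nw.frame b (HCoord p) :=
  (sum_nw_coframe (HCoord p) _).symm

/-- The conformal map intertwines the symbols of the two Dirac operators. -/
theorem sum_gamma_weightedSpin_symbol (p : Coord) (T : Coord →ₗ[ℝ] Spinor) :
    ∑ c, gamma c *ᵥ (weightedSpin p *ᵥ T (fderiv ℝ HCoord p (mink.frame c p)))
      = (Omega p : ℂ)⁻¹ • weightedSpin p *ᵥ ∑ b, gamma b *ᵥ T (nw.frame b (HCoord p)) := by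
  have hM (b d : Fin 4) : ∑ c, (diffH p b c : ℂ) * (confLorentz p c d : ℂ)
      = (Omega p : ℂ)⁻¹ * if b = d then 1 else 0 := by
    have hO := (Omega_pos p).ne'
    have h := congrFun₂ (relatesCoframes_confLorentz.diffH_mul_smul p) b d
    rw [Matrix.mul_smul, Matrix.smul_apply, Matrix.one_apply, Matrix.mul_apply, smul_eq_mul] at h
    have h' : ∑ c, diffH p b c * confLorentz p c d = (Omega p)⁻¹ * if b = d then 1 else 0 := by
      rw [← h, inv_mul_cancel_left₀ hO]
    have h'' := congrArg (fun x : ℝ => (x : ℂ)) h'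
    push_cast at h''
    rw [h'']
    split_ifs <;> simp
  have hT (c : Fin 4) : T (fderiv ℝ HCoord p (mink.frame c p))
      = ∑ b, (diffH p b c : ℂ) • T (nw.frame b (HCoord p)) := by
    rw [fderiv_HCoord_frame, map_sum]
    refine Finset.sum_congr rfl fun b _ => ?_
    rw [map_smul]
    rfl
  simp only [hT, Matrix.mulVec_mulVec, gamma_mul_weightedSpin]
  simp only [← Matrix.mulVec_mulVec, ← Matrix.mulVec_sum, ← Matrix.mulVec_smul]
  congr 1
  simp only [Matrix.mulVec_sum, Matrix.sum_mulVec, Matrix.mulVec_smul, Matrix.smul_mulVec,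
    Finset.smul_sum, smul_smul]
  rw [Finset.sum_comm]
  refine Finset.sum_congr rfl fun b _ => ?_
  rw [Finset.sum_comm]
  simp only [← Finset.sum_smul]
  simp [hM]

/-- Conformal covariance: `Ω^(-3/2) S` intertwines the Dirac operators up to the factor `Ω⁻¹`. -/
theorem mink_dirac_weightedSpin (A : Coord → Coord →L[ℝ] ℝ) {ψ : Coord → Spinor}
    (hψ : ContDiff ℝ ∞ ψ) (p : Coord) :
    mink.dirac (fun p => (A (HCoord p)).comp (fderiv ℝ HCoord p))
      (fun p => weightedSpin p *ᵥ ψ (HCoord p)) p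
      = (Omega p : ℂ)⁻¹ • weightedSpin p *ᵥ nw.dirac A ψ (HCoord p) := by
  -- `T` is the twisted differential `dψ + iAψ` of `ψ` at the image point.
  let T : Coord →ₗ[ℝ] Spinor :=
    { toFun := fun v => fderiv ℝ ψ (HCoord p) v
        + (Complex.I * (A (HCoord p) v : ℂ)) • ψ (HCoord p)
      map_add' := fun v w => by
        simp only [map_add, Complex.ofReal_add]
        module
      map_smul' := fun r v => by
        ext i
        simp
        ring }
  have hT (v : Coord) : T v = fderiv ℝ ψ (HCoord p) v
      + (Complex.I * (A (HCoord p) v : ℂ)) • ψ (HCoord p) := rfl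
  rw [mink_dirac, nw_dirac]
  simp only [← hT]
  rw [Matrix.mulVec_sub, smul_sub, ← sum_gamma_weightedSpin_symbol]
  have hK : (Omega p : ℂ)⁻¹ • weightedSpin p *ᵥ cliffordConnection *ᵥ ψ (HCoord p)
      = -∑ c, gamma c *ᵥ weightedSpinDeriv p (mink.frame c p) *ᵥ ψ (HCoord p) := by
    simp only [Matrix.mulVec_mulVec]
    rw [← Matrix.sum_mulVec, sum_gamma_weightedSpinDeriv, Matrix.neg_mulVec, neg_neg,
      Matrix.smul_mulVec]
  rw [hK, sub_neg_eq_add, ← Finset.sum_add_distrib]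
  refine Finset.sum_congr rfl fun c _ => ?_
  rw [fderiv_weightedSpin_mulVec hψ, hT, ← Matrix.mulVec_add]
  congr 1
  rw [Matrix.mulVec_add, Matrix.mulVec_smul]
  simp only [ContinuousLinearMap.comp_apply]
  abel

/-! ### Uniqueness of the spin lift -/

/-- Schur's lemma for the Weyl representation: only scalars commute with the gamma matrices. -/
theorem eq_smul_one_of_commute_gamma {M : Matrix (Fin 4) (Fin 4) ℂ}
    (hM : ∀ a, gamma a * M = M * gamma a) : M = M 0 0 • (1 : Matrix (Fin 4) (Fin 4) ℂ) := by
  have h0 (i j) := congrFun₂ (hM 0) i j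
  have h1 (i j) := congrFun₂ (hM 1) i j
  have h2 (i j) := congrFun₂ (hM 2) i j
  have h3 (i j) := congrFun₂ (hM 3) i j
  simp only [Matrix.mul_apply, Fin.sum_univ_four, gamma] at h0 h1 h2 h3
  simp [Fin.forall_fin_succ] at h0 h1 h2 h3
  have hI := Complex.I_mul_I
  ext i j
  fin_cases i <;> fin_cases j <;> simp <;> grind

/-- Two spin lifts of the same Lorentz transformation differ by a fourth root of unity, which is
constant by continuity. -/
theorem IsSpinLift.eq_smul {G : Coord → Matrix (Fin 4) (Fin 4) ℝ}
    {S S₀ : Coord → Matrix (Fin 4) (Fin 4) ℂ} (hS : IsSpinLift G S) (hS₀ : IsSpinLift G S₀) :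
    ∃ c : ℂ, ∀ p, S p = c • S₀ p := by
  have hd (p : Coord) : IsUnit (S p).det := by simp [det_of_mem_Pin13 (hS.2.1 p)]
  have hd₀ (p : Coord) : IsUnit (S₀ p).det := by simp [det_of_mem_Pin13 (hS₀.2.1 p)]
  have hcomm (p : Coord) (a : Fin 4) :
      gamma a * (S p * (S₀ p)⁻¹) = S p * (S₀ p)⁻¹ * gamma a := by
    have h := (hS.2.2 p a).trans (hS₀.2.2 p a).symm
    calc gamma a * (S p * (S₀ p)⁻¹)
        = S p * ((S p)⁻¹ * gamma a * S p) * (S₀ p)⁻¹ := by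
          simp only [← mul_assoc, Matrix.mul_nonsing_inv _ (hd p), one_mul]
      _ = S p * (S₀ p)⁻¹ * gamma a := by
          rw [h]
          simp only [mul_assoc, Matrix.mul_nonsing_inv _ (hd₀ p), mul_one]
  set c : Coord → ℂ := fun p => (S p * (S₀ p)⁻¹) 0 0
  have hSc (p : Coord) : S p = c p • S₀ p := by
    have h := eq_smul_one_of_commute_gamma (hcomm p)
    calc S p = S p * (S₀ p)⁻¹ * S₀ p := by
          rw [mul_assoc, Matrix.nonsing_inv_mul _ (hd₀ p), mul_one]
      _ = c p • S₀ p := by rw [h, Matrix.smul_mul, one_mul]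
  have hroot (p : Coord) : c p ^ 4 = 1 := by
    have h := congrArg Matrix.det (hSc p)
    rw [Matrix.det_smul, det_of_mem_Pin13 (hS.2.1 p), det_of_mem_Pin13 (hS₀.2.1 p)] at h
    simpa using h.symm
  -- The determinant is one, so that the inverse is the adjugate, which depends continuously on `p`.
  have hinv : (fun p => (S₀ p)⁻¹) = fun p => (S₀ p).adjugate := by
    funext p
    simp [Matrix.inv_def, det_of_mem_Pin13 (hS₀.2.1 p)]
  have hcont : Continuous c := by
    have h : Continuous fun p => (S₀ p)⁻¹ := by
      rw [hinv]
      exact hS₀.1.matrix_adjugate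
    exact (hS.1.matrix_mul h).matrix_elem 0 0
  have hfin : {z : ℂ | z ^ 4 = 1}.Finite := by
    have h := (Polynomial.nthRoots 4 (1 : ℂ)).toFinset.finite_toSet
    refine h.subset fun z hz => ?_
    simpa [Polynomial.mem_nthRoots] using hz
  have hconst (p q : Coord) : c p = c q := by
    exact isPreconnected_univ.constant_of_mapsTo hfin.isDiscrete hcont.continuousOn
      (fun p _ => hroot p) trivial trivial
  exact ⟨c 0, fun p => by rw [hSc p, hconst p 0]⟩

end NappiWitten

end

open NappiWitten in
theorem mainTheorem3 :
    (∃! G, NappiWitten.RelatesCoframes G) ∧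
    ∀ G, NappiWitten.RelatesCoframes G →
      (∀ p, NappiWitten.IsLorentz (G p)) ∧
      (∃ S, NappiWitten.IsSpinLift G S) ∧
      ∀ (S : NappiWitten.Coord → Matrix (Fin 4) (Fin 4) ℂ), NappiWitten.IsSpinLift G S →
      ∀ (A : NappiWitten.NW → NappiWitten.Coord →L[ℝ] ℝ), NappiWitten.NWSmooth A →
      ∀ (Ψ : NappiWitten.NW → NappiWitten.Spinor), NappiWitten.IsHarmonicNW A Ψ →
        NappiWitten.IsHarmonicMink (NappiWitten.pullbackH A)
          (fun p => (S p).mulVec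
            (((NappiWitten.Omega p ^ (-(3 / 2) : ℝ) : ℝ) : ℂ) • Ψ (NappiWitten.H p))) := by
  refine ⟨⟨confLorentz, relatesCoframes_confLorentz,
    fun G hG => hG.unique relatesCoframes_confLorentz⟩, fun G hG => ?_⟩
  obtain rfl := hG.unique relatesCoframes_confLorentz
  have hlift : IsSpinLift confLorentz confSpin :=
    ⟨continuous_confSpin, confSpin_mem_Pin13, confLorentz_spin⟩
  refine ⟨confLorentz_isLorentz, ⟨confSpin, hlift⟩, fun S hS A _ Ψ hΨ => ?_⟩
  obtain ⟨c, hc⟩ := hS.eq_smul hlift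
  have hΦ : (fun p => (S p).mulVec (((Omega p ^ (-(3 / 2) : ℝ) : ℝ) : ℂ) • Ψ (H p)))
      = c • fun p => weightedSpin p *ᵥ (Ψ ∘ cover) (HCoord p) := by
    funext p
    simp only [hc, weightedSpin, Pi.smul_apply, Matrix.smul_mulVec, Matrix.mulVec_smul]
    rw [smul_comm]
    rfl
  rw [hΦ]
  have hsm := contDiff_weightedSpin_mulVec hΨ.1
  refine ⟨hsm.const_smul c, fun p => ?_⟩
  have h := mink_dirac_weightedSpin (A ∘ cover) hΨ.1 p
  rw [hΨ.2, Matrix.mulVec_zero, smul_zero, mink_dirac] at h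
  rw [mink_dirac, ← smul_zero c, ← h, Finset.smul_sum]
  refine Finset.sum_congr rfl fun a _ => ?_
  rw [fderiv_const_smul (hsm.differentiable (by simp) p), ← Matrix.mulVec_smul, smul_add,
    smul_comm c]
  rfl
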